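/- For an integer $h\ge 2$ let $a_1=h(h+1)$, $a_2=h(h+1)+1$, $a_3=(h+1)^2$, $a_4=(h+1)^2+1$ be the generators of Arslan's semigroup $A_h=\langle a_1,a_2,a_3,a_4\rangle$. Let $K$ be any field, let $I_{A_h}\subset K[x_1,x_2,x_3,x_4]$ be the kernel of the $K$-algebra homomorphism $K[x_1,x_2,x_3,x_4]\to K[t]$, $x_i\mapsto t^{a_i}$, and let $I_{A_h}^h\subset K[x_0,x_1,x_2,x_3,x_4]$ be its homogenization with respect to $x_0$ (the superscript $h$ denotes homogenization), i.e. the ideal generated by the homogenizations of all elements of $I_{A_h}$; it is the homogeneous ideal of the projective monomial curve in $\mathbb{P}^4$ associated to $A_h$. Then this curve is arithmetically Cohen–Macaulay, that is, the homogeneous coordinate ring $K[x_0,x_1,x_2,x_3,x_4]/I_{A_h}^h$ is a Cohen–Macaulay ring. -/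

import Mathlib

open MvPolynomial

noncomputable section

/-- The toric ideal `I(a) ⊆ K[x₁, …, xₙ]` of a sequence `a₁, …, aₙ`: the kernel of the
`K`-algebra homomorphism `K[x₁, …, xₙ] → K[t]` with `xᵢ ↦ t ^ aᵢ`.
The variable `xᵢ` is `X (i - 1)`, with index in `Fin n`. -/
def toricIdeal (K : Type*) [Field K] {n : ℕ} (a : Fin n → ℕ) : Ideal (MvPolynomial (Fin n) K) :=
  RingHom.ker (aeval (R := K) fun i => (Polynomial.X : Polynomial K) ^ a i)

/-- The homogenization `f^h` of `f ∈ K[x₁, …, xₙ]` with respect to a new variable `x₀`: every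
monomial `x ^ d` of `f` is replaced by `x₀ ^ (deg f - |d|) * x ^ d`. In `Fin (n + 1)` the index `0`
is the variable `x₀`. For `d ∈ f.support` the natural-number subtraction does not truncate. -/
def homogenizePoly {K : Type*} [Field K] {n : ℕ} (f : MvPolynomial (Fin n) K) :
    MvPolynomial (Fin (n + 1)) K :=
  ∑ d ∈ f.support, monomial (Finsupp.cons (f.totalDegree - d.degree) d) (coeff d f)

/-- The homogenization `I^h` of an ideal `I`: the ideal generated by all `f^h` with `f ∈ I`. -/
def homogenizeIdeal {K : Type*} [Field K] {n : ℕ} (I : Ideal (MvPolynomial (Fin n) K)) :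
    Ideal (MvPolynomial (Fin (n + 1)) K) :=
  Ideal.span (homogenizePoly '' (I : Set (MvPolynomial (Fin n) K)))

/-- The depth of a local ring: the supremum of the lengths of the regular sequences
in its maximal ideal. -/
def localDepth (R : Type*) [CommRing R] [IsLocalRing R] : ℕ∞ :=
  ⨆ (rs : List R) (_ : (∀ r ∈ rs, r ∈ IsLocalRing.maximalIdeal R) ∧
    RingTheory.Sequence.IsRegular R rs), (rs.length : ℕ∞)

/-- A commutative ring is Cohen-Macaulay if it is Noetherian and each of its localizations at
a maximal ideal has depth equal to its Krull dimension. -/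
structure IsCohenMacaulayRing (R : Type*) [CommRing R] : Prop where
  isNoetherianRing : IsNoetherianRing R
  depth_eq_dim : ∀ (m : Ideal R) [m.IsMaximal],
    ((localDepth (Localization.AtPrime m) : ℕ∞) : WithBot ℕ∞) =
      ringKrullDim (Localization.AtPrime m)

/-- The projective monomial curve of the sequence `a` is arithmetically Cohen-Macaulay over `K` if
its ideal `I(a)^h` is a Cohen-Macaulay ideal, that is, if its homogeneous coordinate ring
`K[x₀, …, xₙ] / I(a)^h` is Cohen-Macaulay. -/
def IsArithmeticallyCohenMacaulay (K : Type*) [Field K] {n : ℕ} (a : Fin n → ℕ) : Prop :=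
  IsCohenMacaulayRing (MvPolynomial (Fin (n + 1)) K ⧸ homogenizeIdeal (toricIdeal K a))

/-- The generators of Arslan's semigroup `A_h`, listed increasingly. -/
def arslanSeq (h : ℕ) : Fin 4 → ℕ :=
  ![h * (h + 1), h * (h + 1) + 1, (h + 1) ^ 2, (h + 1) ^ 2 + 1]

end

/-! The coordinate ring is free of rank `a₄ = (h+1)² + 1` over `K[x₀, x₄]`, and a finite flat
algebra over a polynomial ring in two variables is Cohen–Macaulay
(`isCohenMacaulayRing_of_finite_of_flat`).

For the basis, call `a₄ · deg - weight` the colength of a monomial in `x₁, …, x₄`. The variables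
have colengths `h+2, h+1, 1, 0`, so `x₁` does the work of `x₂x₃` in half the degree. For each
residue `r = (h+1)α + β` modulo `a₄`, with `β ≤ h`, the basis contains a monomial in `x₁, x₂, x₃` of
colength `r` and degree `max α β`. A monomial of colength `J a₄ + r` has degree at least `J + max α
β` (`Arslan.div_add_minDegree_le`), so it can be traded for `x₀ ^ J` times powers of `x₀, x₄` and
the basis monomial: monomials of equal degree and weight agree in the quotient. Independence holds
because the basis weights are distinct modulo `a₄`. -/

/-! ### Depth and dimension of finite flat algebras over `K[X][Y]`. -/

theorem Polynomial.isWeaklyRegular_C_map {K : Type*} [Field K] {f g : Polynomial K}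
    (hf : f ≠ 0) (hg : g.Monic) :
    RingTheory.Sequence.IsWeaklyRegular (Polynomial (Polynomial K))
      [Polynomial.C f, g.map Polynomial.C] := by
  refine .cons (IsSMulRegular.of_ne_zero (by simpa using hf)) (.cons ?_ (.nil _ _))
  rw [isSMulRegular_iff_right_eq_zero_of_smul]
  intro x hx
  obtain ⟨p, rfl⟩ := Submodule.Quotient.mk_surjective _ x
  rw [← Submodule.Quotient.mk_smul, Submodule.Quotient.mk_eq_zero] at hx
  rw [Submodule.Quotient.mk_eq_zero]
  rw [Submodule.mem_smul_pointwise_iff_exists] at hx ⊢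
  obtain ⟨b, -, hb⟩ := hx
  have key : ∀ s : Polynomial (Polynomial K), Polynomial.C f ∣ s ↔
      s.map (Ideal.Quotient.mk (Ideal.span {f})) = 0 := fun s ↦ by
    simp [Polynomial.C_dvd_iff_dvd_coeff, Polynomial.ext_iff, Ideal.Quotient.eq_zero_iff_dvd]
  have h1 : Polynomial.C f ∣ g.map Polynomial.C * p := ⟨b, by simpa using hb.symm⟩
  rw [key, Polynomial.map_mul] at h1
  -- Reduction modulo `f` keeps `g` monic, and a monic polynomial is a nonzerodivisor over any ring.
  have hm : ((g.map Polynomial.C).map (Ideal.Quotient.mk (Ideal.span {f}))).Monic :=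
    (hg.map _).map _
  obtain ⟨c, hc⟩ := (key p).2 (hm.mul_right_eq_zero_iff.1 h1)
  exact ⟨c, trivial, hc.symm⟩

/-- By the Nullstellensatz the residue field is finite over `K`, so `n` contains a monic polynomial
in each variable separately. -/
theorem exists_isWeaklyRegular_of_isMaximal {K : Type*} [Field K]
    (n : Ideal (Polynomial (Polynomial K))) [n.IsMaximal] :
    ∃ f g : Polynomial (Polynomial K), f ∈ n ∧ g ∈ n ∧
      RingTheory.Sequence.IsWeaklyRegular (Polynomial (Polynomial K)) [f, g] := by
  let _ := Ideal.Quotient.field n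
  have : Algebra.FiniteType K (Polynomial (Polynomial K)) :=
    .trans (S := Polynomial K) inferInstance inferInstance
  have : Algebra.FiniteType K (Polynomial (Polynomial K) ⧸ n) := inferInstance
  have : Module.Finite K (Polynomial (Polynomial K) ⧸ n) :=
    finite_of_finite_type_of_isJacobsonRing _ _
  have hint (x : Polynomial (Polynomial K) ⧸ n) : IsIntegral K x := Algebra.IsIntegral.isIntegral x
  obtain ⟨f, hf, hf'⟩ := hint (Ideal.Quotient.mk n (Polynomial.C Polynomial.X))
  obtain ⟨g, hg, hg'⟩ := hint (Ideal.Quotient.mk n Polynomial.X)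
  refine ⟨_, _, ?_, ?_, Polynomial.isWeaklyRegular_C_map hf.ne_zero hg⟩
  · rw [← Ideal.Quotient.eq_zero_iff_mem, ← hf']
    have : (Polynomial.eval₂RingHom (algebraMap K (Polynomial (Polynomial K) ⧸ n))
      (Ideal.Quotient.mk n (Polynomial.C Polynomial.X))) =
      (Ideal.Quotient.mk n).comp Polynomial.C := by
      ext
      · simp; rfl
      · simp
    exact (RingHom.congr_fun this f).symm
  · rw [← Ideal.Quotient.eq_zero_iff_mem, ← hg']
    have : (Polynomial.eval₂RingHom (algebraMap K (Polynomial (Polynomial K) ⧸ n))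
      (Ideal.Quotient.mk n Polynomial.X)) =
      (Ideal.Quotient.mk n).comp (Polynomial.mapRingHom Polynomial.C) := by
      ext
      · simp; rfl
      · simp
    exact (RingHom.congr_fun this g).symm

theorem ringKrullDim_polynomial_polynomial_field (K : Type*) [Field K] :
    ringKrullDim (Polynomial (Polynomial K)) = 2 := by
  rw [Polynomial.ringKrullDim_of_isNoetherianRing, Polynomial.ringKrullDim_of_isNoetherianRing,
    ringKrullDim_eq_zero_of_field]
  norm_num

theorem localDepth_le_ringKrullDim (R : Type*) [CommRing R] [IsLocalRing R] [IsNoetherianRing R] :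
    ((localDepth R : ℕ∞) : WithBot ℕ∞) ≤ ringKrullDim R := by
  obtain ⟨d, hd⟩ : ∃ d : ℕ∞, ringKrullDim R = d :=
    ⟨_, (WithBot.coe_unbot _ ringKrullDim_ne_bot).symm⟩
  rw [hd, WithBot.coe_le_coe]
  refine iSup₂_le fun rs hrs ↦ ?_
  rw [← WithBot.coe_le_coe, ← hd, ← ringKrullDim_add_length_eq_ringKrullDim_of_isRegular rs hrs.2]
  have := hrs.2.quot_ofList_smul_nontrivial ⊤
  have : Nontrivial (R ⧸ Ideal.ofList rs) := by simpa using this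
  exact le_add_of_nonneg_left ringKrullDim_nonneg_of_nontrivial

/-- A finite flat algebra over a polynomial ring in two variables over a field is
Cohen-Macaulay. -/
theorem isCohenMacaulayRing_of_finite_of_flat (K R : Type*) [Field K] [CommRing R]
    [Algebra (Polynomial (Polynomial K)) R] [Module.Finite (Polynomial (Polynomial K)) R]
    [Module.Flat (Polynomial (Polynomial K)) R] : IsCohenMacaulayRing R := by
  have hN : IsNoetherianRing R := IsNoetherianRing.of_finite (Polynomial (Polynomial K)) R
  refine ⟨hN, fun m _ ↦ le_antisymm (localDepth_le_ringKrullDim _) ?_⟩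
  have hdim : ringKrullDim (Localization.AtPrime m) ≤ 2 := by
    rw [IsLocalization.AtPrime.ringKrullDim_eq_height m,
      ← ringKrullDim_polynomial_polynomial_field K]
    refine (Ideal.height_le_ringKrullDim_of_ne_top (Ideal.IsPrime.ne_top')).trans ?_
    -- Incomparability: contraction of primes along an integral extension is strictly monotone.
    exact Order.krullDim_le_of_strictMono
      (fun I : PrimeSpectrum R ↦ PrimeSpectrum.comap (algebraMap (Polynomial (Polynomial K)) R) I)
      fun I J hIJ ↦ Ideal.IsIntegral.comap_lt_comap (I := I.asIdeal) (J := J.asIdeal) hIJ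
  refine hdim.trans ?_
  have : (m.comap (algebraMap (Polynomial (Polynomial K)) R)).IsMaximal :=
    Ideal.isMaximal_comap_of_isIntegral_of_isMaximal m
  obtain ⟨f, g, hf, hg, hfg⟩ := exists_isWeaklyRegular_of_isMaximal
    (m.comap (algebraMap (Polynomial (Polynomial K)) R))
  have hreg := (hfg.of_flat (S := R)).isRegular_of_isLocalization_of_mem
    (Localization.AtPrime m) m (by simpa using ⟨hf, hg⟩)
  have hle : (2 : ℕ∞) ≤ localDepth (Localization.AtPrime m) := by
    refine le_iSup₂_of_le _ ⟨?_, hreg⟩ (by simp)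
    simp only [List.map_cons, List.map_nil, List.mem_cons, List.not_mem_nil, or_false,
      forall_eq_or_imp, forall_eq, IsLocalization.AtPrime.to_map_mem_maximal_iff _ m]
    exact ⟨hf, hg⟩
  exact WithBot.coe_le_coe.2 hle

/-! ### Parametrization and binomials of the projective monomial curve. -/

theorem aeval_X_pow_monomial (K : Type*) [Field K] {n : ℕ} (a : Fin n → ℕ) (d : Fin n →₀ ℕ)
    (c : K) : aeval (R := K) (fun i => (Polynomial.X : Polynomial K) ^ a i) (monomial d c) =
      Polynomial.monomial (∑ k, d k * a k) c := by
  rw [aeval_monomial, Finsupp.prod_fintype _ _ (by simp), ← Polynomial.C_mul_X_pow_eq_monomial]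
  simp [← pow_mul, Finset.prod_pow_eq_pow_sum, mul_comm]

/-- The parametrization `x₀ ↦ s`, `xᵢ ↦ s * t ^ aᵢ` of the projective monomial curve, with values
in `K[s][t]`. -/
noncomputable def curveParam (K : Type*) [Field K] {n : ℕ} (a : Fin n → ℕ) :
    MvPolynomial (Fin (n + 1)) K →ₐ[K] Polynomial (Polynomial K) :=
  aeval (Fin.cons (Polynomial.C Polynomial.X)
    fun i ↦ Polynomial.C Polynomial.X * Polynomial.X ^ a i)

theorem curveParam_monomial (K : Type*) [Field K] {n : ℕ} (a : Fin n → ℕ) (i : ℕ)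
    (d : Fin n →₀ ℕ) (c : K) : curveParam K a (monomial (Finsupp.cons i d) c) =
      Polynomial.monomial (∑ k, d k * a k) (Polynomial.monomial (i + d.degree) c) := by
  rw [curveParam, aeval_monomial, Finsupp.prod_fintype _ _ (by simp), Fin.prod_univ_succ,
    ← Polynomial.C_mul_X_pow_eq_monomial, ← Polynomial.C_mul_X_pow_eq_monomial,
    Finsupp.degree_eq_sum]
  simp only [Fin.cons_zero, Fin.cons_succ, Finsupp.cons_zero, Finsupp.cons_succ, mul_pow,
    ← pow_mul, Finset.prod_mul_distrib, Finset.prod_pow_eq_pow_sum, map_mul, map_pow, pow_add]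
  simp only [mul_comm (a _), ← mul_assoc]
  rfl

theorem homogenizeIdeal_toricIdeal_le_ker (K : Type*) [Field K] {n : ℕ} (a : Fin n → ℕ) :
    homogenizeIdeal (toricIdeal K a) ≤ RingHom.ker (curveParam K a) := by
  rw [homogenizeIdeal, Ideal.span_le]
  rintro _ ⟨f, hf, rfl⟩
  rw [SetLike.mem_coe, RingHom.mem_ker, homogenizePoly, map_sum]
  have hf' : aeval (R := K) (fun i => (Polynomial.X : Polynomial K) ^ a i) f = 0 := hf
  rw [f.as_sum, map_sum] at hf'
  -- Multiplying `f(t ^ a) = 0` by `s ^ deg f` gives the image of `f^h`, all of whose monomials have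
  -- degree `deg f`.
  have := congrArg (fun p ↦ Polynomial.C (Polynomial.X ^ f.totalDegree) *
    Polynomial.map (Polynomial.C (R := K)) p) hf'
  simp only [Polynomial.map_zero, mul_zero, Polynomial.map_sum, Finset.mul_sum,
    aeval_X_pow_monomial] at this
  rw [← this]
  refine Finset.sum_congr rfl fun d hd ↦ ?_
  have hle : d.degree ≤ f.totalDegree := le_totalDegree hd
  rw [curveParam_monomial, Nat.sub_add_cancel hle, Polynomial.map_monomial,
    Polynomial.C_mul_monomial, Polynomial.X_pow_mul_C, Polynomial.C_mul_X_pow_eq_monomial]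

theorem homogenizePoly_binomial {K : Type*} [Field K] {n : ℕ} {d d' : Fin n →₀ ℕ} (hne : d ≠ d')
    (hdeg : d'.degree ≤ d.degree) :
    homogenizePoly (monomial d (1 : K) - monomial d' 1) =
      monomial (Finsupp.cons 0 d) 1 - monomial (Finsupp.cons (d.degree - d'.degree) d') 1 := by
  classical
  have hsupp : (monomial d (1 : K) - monomial d' 1).support = {d, d'} := by
    ext e
    simp only [mem_support_iff, coeff_sub, coeff_monomial, Finset.mem_insert,
      Finset.mem_singleton]
    by_cases h1 : d = e
    · subst h1; simp [hne.symm]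
    · by_cases h2 : d' = e
      · subst h2; simp [hne]
      · simp [h1, h2, Ne.symm h1, Ne.symm h2]
  have htd : (monomial d (1 : K) - monomial d' 1).totalDegree = d.degree := by
    rw [totalDegree, hsupp]
    simp only [Finset.sup_insert, Finset.sup_singleton]
    exact sup_eq_left.2 hdeg
  rw [homogenizePoly, htd, hsupp, Finset.sum_pair hne]
  simp [coeff_monomial, hne, hne.symm, sub_eq_add_neg]

theorem monomial_sub_monomial_mem_homogenizeIdeal (K : Type*) [Field K] {n : ℕ} (a : Fin n → ℕ)
    {i i' : ℕ} {d d' : Fin n →₀ ℕ} (hdeg : i + d.degree = i' + d'.degree)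
    (hw : ∑ k, d k * a k = ∑ k, d' k * a k) :
    monomial (Finsupp.cons i d) (1 : K) - monomial (Finsupp.cons i' d') 1 ∈
      homogenizeIdeal (toricIdeal K a) := by
  wlog hle : d'.degree ≤ d.degree generalizing i i' d d'
  · rw [← neg_sub]
    exact neg_mem (this hdeg.symm hw.symm (le_of_not_ge hle))
  by_cases hne : d = d'
  · subst hne
    obtain rfl : i = i' := by lia
    simp
  have hmem : monomial d (1 : K) - monomial d' 1 ∈ toricIdeal K a := by
    rw [toricIdeal, RingHom.mem_ker, map_sub, aeval_X_pow_monomial, aeval_X_pow_monomial, hw,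
      sub_self]
  have h1 : homogenizePoly (monomial d (1 : K) - monomial d' 1) ∈
    homogenizeIdeal (toricIdeal K a) := Ideal.subset_span ⟨_, hmem, rfl⟩
  rw [homogenizePoly_binomial hne hle] at h1
  have h2 := Ideal.mul_mem_left _ (monomial (Finsupp.cons i 0) (1 : K)) h1
  have h3 : ∀ (k : ℕ) (e : Fin n →₀ ℕ),
      Finsupp.cons i 0 + Finsupp.cons k e = Finsupp.cons (i + k) e := fun k e ↦ by
    ext l; refine Fin.cases ?_ (fun l ↦ ?_) l <;> simp
  rw [mul_sub, monomial_mul, monomial_mul, h3, h3, mul_one] at h2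
  rwa [show i' = i + (d.degree - d'.degree) by lia]

/-! ### Apéry monomials of `A_h`. -/

namespace Arslan

/-- The exponent vector `(i, d)` with `d = (e₁, e₂, e₃, e₄)`. -/
noncomputable def expo (e₁ e₂ e₃ e₄ : ℕ) : Fin 4 →₀ ℕ :=
  Finsupp.equivFunOnFinite.symm ![e₁, e₂, e₃, e₄]

theorem degree_expo (e₁ e₂ e₃ e₄ : ℕ) : (expo e₁ e₂ e₃ e₄).degree = e₁ + e₂ + e₃ + e₄ := by
  rw [Finsupp.degree_eq_sum]
  simp [expo, Fin.sum_univ_four]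

theorem sum_expo_mul_arslanSeq (h e₁ e₂ e₃ e₄ : ℕ) :
    ∑ k, expo e₁ e₂ e₃ e₄ k * arslanSeq h k = e₁ * (h * (h + 1)) + e₂ * (h * (h + 1) + 1) +
      e₃ * (h + 1) ^ 2 + e₄ * ((h + 1) ^ 2 + 1) := by
  simp [expo, Fin.sum_univ_four, arslanSeq]

theorem eq_expo (d : Fin 4 →₀ ℕ) : d = expo (d 0) (d 1) (d 2) (d 3) := by
  ext k; fin_cases k <;> rfl

/-- The least degree of a monomial in `x₁, x₂, x₃` of colength `r`, for `r ≤ (h + 1) ^ 2`. -/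
def minDegree (h r : ℕ) : ℕ := max (r / (h + 1)) (r % (h + 1))

/-- The exponents of the monomial in `x₁, x₂, x₃` representing the residue `r`. -/
noncomputable def apery (h r : ℕ) : ℕ → Fin 4 →₀ ℕ :=
  expo (min (r / (h + 1)) (r % (h + 1)))
    (r / (h + 1) - min (r / (h + 1)) (r % (h + 1))) (r % (h + 1) - min (r / (h + 1)) (r % (h + 1)))

theorem degree_apery (h r j : ℕ) : (apery h r j).degree = minDegree h r + j := by
  rw [apery, degree_expo, minDegree]
  lia

theorem weight_apery (h r j : ℕ) : ∑ k, apery h r j k * arslanSeq h k + r =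
    ((h + 1) ^ 2 + 1) * (minDegree h r + j) := by
  rw [apery, sum_expo_mul_arslanSeq, minDegree]
  have hr := Nat.div_add_mod r (h + 1)
  generalize r / (h + 1) = α at *
  generalize r % (h + 1) = β at *
  subst hr
  rcases le_total α β with hle | hle
  · obtain ⟨c, rfl⟩ := Nat.exists_eq_add_of_le hle
    simp; ring
  · obtain ⟨c, rfl⟩ := Nat.exists_eq_add_of_le hle
    simp; ring

/-- The colength is `A + (h+1)C` with `A = e₁ + e₃` and `C = e₁ + e₂`, both at most the degree. It
thus suffices to bound `max A C` from below among all solutions of one linear equation. -/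
theorem div_add_minDegree_le (h e₁ e₂ e₃ : ℕ) :
    (e₃ + (h + 1) * e₂ + (h + 2) * e₁) / ((h + 1) ^ 2 + 1) +
      minDegree h ((e₃ + (h + 1) * e₂ + (h + 2) * e₁) % ((h + 1) ^ 2 + 1)) ≤ e₁ + e₂ + e₃ := by
  have hv := Nat.div_add_mod (e₃ + (h + 1) * e₂ + (h + 2) * e₁) ((h + 1) ^ 2 + 1)
  have hr := Nat.mod_lt (e₃ + (h + 1) * e₂ + (h + 2) * e₁) (Nat.succ_pos ((h + 1) ^ 2))
  rw [Nat.succ_eq_add_one] at hr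
  generalize (e₃ + (h + 1) * e₂ + (h + 2) * e₁) / ((h + 1) ^ 2 + 1) = J at *
  generalize (e₃ + (h + 1) * e₂ + (h + 2) * e₁) % ((h + 1) ^ 2 + 1) = r at *
  have hab := Nat.div_add_mod r (h + 1)
  have hb : r % (h + 1) < h + 1 := Nat.mod_lt r (Nat.succ_pos h)
  rw [minDegree]
  generalize r / (h + 1) = α at *
  generalize r % (h + 1) = β at *
  have hα : α ≤ h + 1 := by
    by_contra! hc
    nlinarith
  have hmain : ((e₁ + e₃ : ℕ) : ℤ) + (h + 1) * (e₁ + e₂ : ℕ) =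
      (h + 1) * α + β + J * ((h + 1) ^ 2 + 1) := by
    zify at hv hab
    push_cast
    linarith
  suffices J + max α β ≤ max (e₁ + e₃) (e₁ + e₂) by lia
  generalize e₁ + e₃ = A at *
  generalize e₁ + e₂ = C at *
  -- The solutions are `(A, C) = (β + J + (h+1)s, α + J(h+1) - s)`. For `s > 0`, `A` is large enough
  -- because `α ≤ h+1`; for `s ≤ 0` and `J ≥ 1`, `C` is, because `β ≤ h`; for `J = 0`, `A ≥ 0` rules
  -- out `s < 0`.
  obtain ⟨s, hs⟩ : ∃ s : ℤ, (C : ℤ) = α + J * (h + 1) - s := ⟨α + J * (h + 1) - C, by ring⟩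
  have hA : (A : ℤ) = β + J + (h + 1) * s := by rw [hs] at hmain; linarith
  rcases le_or_gt s 0 with h0 | h0
  · rcases Nat.eq_zero_or_pos J with rfl | hJ
    · have : s = 0 := by
        by_contra hne
        have : ((h : ℤ) + 1) * s ≤ (h + 1) * (-1) :=
          mul_le_mul_of_nonneg_left (by lia) (by positivity)
        push_cast at hA
        lia
      subst this
      simp at hs hA
      lia
    · have : (J : ℤ) + max α β ≤ C := by
        have : (J : ℤ) * h ≥ h := by nlinarith
        rw [hs]
        have : (J : ℤ) + α ≤ α + J * (h + 1) - s := by nlinarith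
        have : (J : ℤ) + β ≤ α + J * (h + 1) - s := by nlinarith
        push_cast
        lia
      lia
  · have : (J : ℤ) + h + 1 + β ≤ A := by nlinarith
    lia

/-- Every monomial agrees in degree and weight with the product of an Apéry monomial and a
monomial in `x₀, x₄`. -/
theorem exists_apery (h e₀ : ℕ) (d : Fin 4 →₀ ℕ) : ∃ r < (h + 1) ^ 2 + 1, ∃ i j,
    e₀ + d.degree = i + (apery h r j).degree ∧
    ∑ k, d k * arslanSeq h k = ∑ k, apery h r j k * arslanSeq h k := by
  obtain ⟨e₁, e₂, e₃, e₄, rfl⟩ : ∃ e₁ e₂ e₃ e₄, d = expo e₁ e₂ e₃ e₄ := ⟨_, _, _, _, eq_expo d⟩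
  have hle := div_add_minDegree_le h e₁ e₂ e₃
  have hv := Nat.div_add_mod (e₃ + (h + 1) * e₂ + (h + 2) * e₁) ((h + 1) ^ 2 + 1)
  have hr := Nat.mod_lt (e₃ + (h + 1) * e₂ + (h + 2) * e₁) (Nat.succ_pos ((h + 1) ^ 2))
  rw [Nat.succ_eq_add_one] at hr
  generalize (e₃ + (h + 1) * e₂ + (h + 2) * e₁) / ((h + 1) ^ 2 + 1) = J at *
  generalize (e₃ + (h + 1) * e₂ + (h + 2) * e₁) % ((h + 1) ^ 2 + 1) = r at *
  -- Each full `a₄` in the colength becomes a factor `x₀`, and `x₄` takes up the remaining degree;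
  -- `hle` keeps the subtraction from truncating.
  refine ⟨r, hr, e₀ + J, e₁ + e₂ + e₃ + e₄ - J - minDegree h r, ?_, ?_⟩
  · rw [degree_apery, degree_expo]
    lia
  · have hw := weight_apery h r (e₁ + e₂ + e₃ + e₄ - J - minDegree h r)
    have hj : minDegree h r + (e₁ + e₂ + e₃ + e₄ - J - minDegree h r) + J =
      e₁ + e₂ + e₃ + e₄ := by lia
    generalize minDegree h r + (e₁ + e₂ + e₃ + e₄ - J - minDegree h r) = m at *
    rw [sum_expo_mul_arslanSeq]
    zify at *
    linear_combination hv - hw - ((h + 1) ^ 2 + 1 : ℤ) * hj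

end Arslan

/-! ### Freeness over `K[x₀, x₄]`. -/

theorem Polynomial.coeff_eval₂_C_mul_monomial {S : Type*} [CommRing S] (u v : S) (d m M : ℕ)
    (p : Polynomial S) :
    (p.eval₂ Polynomial.C (Polynomial.C u * Polynomial.X ^ d) * Polynomial.monomial m v).coeff M =
      p.sum fun j c ↦ if d * j + m = M then c * u ^ j * v else 0 := by
  rw [Polynomial.eval₂_eq_sum, Polynomial.sum, Polynomial.sum, Finset.sum_mul,
    Polynomial.finsetSum_coeff]
  refine Finset.sum_congr rfl fun j _ ↦ ?_
  rw [mul_pow, ← pow_mul, ← Polynomial.C_pow, ← mul_assoc, ← Polynomial.C_mul,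
    Polynomial.C_mul_X_pow_eq_monomial, Polynomial.monomial_mul_monomial,
    Polynomial.coeff_monomial]

namespace Arslan

variable (K : Type*) [Field K] (h : ℕ)

/-- The homogeneous coordinate ring of the projective monomial curve of `A_h`. -/
abbrev CoordRing : Type _ := MvPolynomial (Fin 5) K ⧸ homogenizeIdeal (toricIdeal K (arslanSeq h))

/-- The inclusion of `K[x₀, x₄]`, written as `K[X][Y]`, into the coordinate ring. -/
noncomputable def paramHom : Polynomial (Polynomial K) →+* CoordRing K h :=
  (Ideal.Quotient.mk _).comp
    (Polynomial.eval₂RingHom (Polynomial.eval₂RingHom C (X 0)) (X 4))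

/-- The embedding of the coordinate ring into `K[s][t]`. -/
noncomputable def toPolynomial : CoordRing K h →+* Polynomial (Polynomial K) :=
  Ideal.Quotient.lift _ (curveParam K (arslanSeq h)).toRingHom fun _ hf ↦
    RingHom.mem_ker.1 (homogenizeIdeal_toricIdeal_le_ker K (arslanSeq h) hf)

/-- The element of the coordinate ring given by the Apéry monomial of residue `r`. -/
noncomputable def aperyElem (r : Fin ((h + 1) ^ 2 + 1)) : CoordRing K h :=
  Ideal.Quotient.mk _ (monomial (Finsupp.cons 0 (apery h r 0)) 1)

theorem toPolynomial_paramHom (p : Polynomial (Polynomial K)) :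
    toPolynomial K h (paramHom K h p) = p.eval₂ Polynomial.C
      (Polynomial.C Polynomial.X * Polynomial.X ^ ((h + 1) ^ 2 + 1)) := by
  have : (toPolynomial K h).comp (paramHom K h) = Polynomial.eval₂RingHom Polynomial.C
      (Polynomial.C Polynomial.X * Polynomial.X ^ ((h + 1) ^ 2 + 1)) := by
    refine Polynomial.ringHom_ext' (Polynomial.ringHom_ext (fun c ↦ ?_) ?_) ?_
    · simp [toPolynomial, paramHom, Polynomial.algebraMap_apply]
    · simp [toPolynomial, paramHom, curveParam]
    · simp [toPolynomial, paramHom, curveParam]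
      rfl
  exact RingHom.congr_fun this p

theorem toPolynomial_aperyElem (r : Fin ((h + 1) ^ 2 + 1)) :
    toPolynomial K h (aperyElem K h r) =
      Polynomial.monomial (((h + 1) ^ 2 + 1) * minDegree h r - r)
        (Polynomial.monomial (minDegree h r) 1) := by
  have hw := Nat.eq_sub_of_add_eq (weight_apery h r 0)
  rw [toPolynomial, aperyElem, Ideal.Quotient.lift_mk]
  refine (curveParam_monomial _ _ _ _ _).trans ?_
  rw [degree_apery, hw]
  simp

theorem le_mul_minDegree (r : ℕ) : r ≤ ((h + 1) ^ 2 + 1) * minDegree h r :=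
  (Nat.le_add_left ..).trans (weight_apery h r 0).le

/-- Weights modulo `a₄` recover the residue, since `r, s < a₄`; cancellation then recovers the
exponent of `x₄`. -/
theorem eq_of_mul_add_eq {r s : Fin ((h + 1) ^ 2 + 1)} {i j : ℕ}
    (H : ((h + 1) ^ 2 + 1) * i + (((h + 1) ^ 2 + 1) * minDegree h r - r) =
      ((h + 1) ^ 2 + 1) * j + (((h + 1) ^ 2 + 1) * minDegree h s - s)) : r = s ∧ i = j := by
  have hr := le_mul_minDegree h r
  have hs := le_mul_minDegree h s
  have h1 : (s : ℕ) + ((h + 1) ^ 2 + 1) * (i + minDegree h r) =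
      r + ((h + 1) ^ 2 + 1) * (j + minDegree h s) := by
    rw [mul_add, mul_add]
    lia
  have h2 := congrArg (· % ((h + 1) ^ 2 + 1)) h1
  simp only [Nat.add_mul_mod_self_left, Nat.mod_eq_of_lt s.2, Nat.mod_eq_of_lt r.2] at h2
  obtain rfl : r = s := Fin.ext h2.symm
  exact ⟨rfl, Nat.eq_of_mul_eq_mul_left (Nat.succ_pos _) (Nat.add_right_cancel H)⟩

/-- `K[X][Y]`-algebra structure of the coordinate ring, via `X ↦ x₀` and `Y ↦ x₄`. -/
noncomputable instance : Algebra (Polynomial (Polynomial K)) (CoordRing K h) :=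
  (paramHom K h).toAlgebra

theorem algebraMap_coordRing (p : Polynomial (Polynomial K)) :
    algebraMap (Polynomial (Polynomial K)) (CoordRing K h) p = paramHom K h p := rfl

theorem linearIndependent_aperyElem :
    LinearIndependent (Polynomial (Polynomial K)) (aperyElem K h) := by
  rw [Fintype.linearIndependent_iff]
  intro g hg r
  ext1 j
  -- This power of `t` is the weight of `x₄ ^ j` times the Apéry monomial of `r`, so only the `j`-th
  -- coefficient of `g r` contributes to it.
  have h1 := congrArg (fun x ↦ (toPolynomial K h x).coeff
    (((h + 1) ^ 2 + 1) * j + (((h + 1) ^ 2 + 1) * minDegree h r - r))) hg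
  simp only [map_sum, Algebra.smul_def, map_mul, map_zero, Polynomial.coeff_zero,
    Polynomial.finsetSum_coeff] at h1
  have h2 : ∀ s, (toPolynomial K h (algebraMap _ _ (g s)) *
      toPolynomial K h (aperyElem K h s)).coeff
        (((h + 1) ^ 2 + 1) * j + (((h + 1) ^ 2 + 1) * minDegree h r - r)) =
      if s = r then (g r).coeff j * Polynomial.X ^ j * Polynomial.monomial (minDegree h r) 1
      else 0 := by
    intro s
    rw [toPolynomial_aperyElem, algebraMap_coordRing, toPolynomial_paramHom, Polynomial.coeff_eval₂_C_mul_monomial, Polynomial.sum]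
    split_ifs with hs
    · subst hs
      rw [Finset.sum_eq_single j]
      · simp
      · intro i _ hi
        rw [if_neg fun H ↦ hi (eq_of_mul_add_eq h H).2]
      · intro hj
        simp [Polynomial.notMem_support_iff.1 hj]
    · refine Finset.sum_eq_zero fun i _ ↦ ?_
      rw [if_neg fun H ↦ hs (eq_of_mul_add_eq h H).1]
  simp only [h2, Finset.sum_ite_eq', Finset.mem_univ, if_true] at h1
  simpa using h1

theorem span_aperyElem :
    ⊤ ≤ Submodule.span (Polynomial (Polynomial K)) (Set.range (aperyElem K h)) := by
  rintro x -
  obtain ⟨f, rfl⟩ := Ideal.Quotient.mk_surjective x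
  induction f using MvPolynomial.induction_on' with
  | add p q hp hq => rw [map_add]; exact add_mem hp hq
  | monomial e c =>
    obtain ⟨e₀, d, rfl⟩ : ∃ e₀ d, e = Finsupp.cons e₀ d := ⟨_, _, (Finsupp.cons_tail e).symm⟩
    obtain ⟨r, hr, i, j, hdeg, hw⟩ := exists_apery h e₀ d
    have h1 := monomial_sub_monomial_mem_homogenizeIdeal K (arslanSeq h) hdeg hw
    rw [← Ideal.Quotient.eq] at h1
    have h2 : (Ideal.Quotient.mk _ (monomial (Finsupp.cons e₀ d) c) : CoordRing K h) =
      (Polynomial.monomial j (Polynomial.monomial i c)) • aperyElem K h ⟨r, hr⟩ := by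
      rw [Algebra.smul_def, algebraMap_coordRing, ← mul_one c, ← C_mul_monomial, map_mul, h1, ← map_mul, paramHom, aperyElem,
        RingHom.comp_apply, ← map_mul]
      congr 1
      have h3 : (Finsupp.cons i (apery h r j) : Fin 5 →₀ ℕ) = Finsupp.single 0 i +
          Finsupp.single 4 j + Finsupp.cons 0 (apery h r 0) := by
        ext k
        fin_cases k <;> simp [apery, expo, Finsupp.cons]
      simp only [h3, Polynomial.coe_eval₂RingHom, Polynomial.eval₂_monomial, X_pow_eq_monomial,
        C_mul_monomial, monomial_mul, mul_one]
    rw [h2]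
    exact Submodule.smul_mem _ _ (Submodule.subset_span ⟨_, rfl⟩)

/-- The coordinate ring is free over `K[x₀, x₄]` on the Apéry monomials. -/
noncomputable def aperyBasis :
    Module.Basis (Fin ((h + 1) ^ 2 + 1)) (Polynomial (Polynomial K)) (CoordRing K h) :=
  .mk (linearIndependent_aperyElem K h) (span_aperyElem K h)

end Arslan

theorem proposition4p2 (K : Type*) [Field K] (h : ℕ) (hh : 2 ≤ h) :
    IsArithmeticallyCohenMacaulay K (arslanSeq h) := by
  have := Module.Free.of_basis (Arslan.aperyBasis K h)
  have := Module.Finite.of_basis (Arslan.aperyBasis K h)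
  exact isCohenMacaulayRing_of_finite_of_flat K (Arslan.CoordRing K h)
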